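/- All rings are commutative with unit. For a ring $R$, an $R$-algebra $B$ is called \emph{fppf} if it is faithfully flat as an $R$-module and of finite presentation as an $R$-algebra, and \emph{finite} if it is finitely generated as an $R$-module; it \emph{admits a retraction} if there is a ring homomorphism $B\to R$ whose composite with the structure homomorphism $R\to B$ is the identity of $R$. A ring $R$ is called \emph{fppf-local} if it is a local ring and every fppf $R$-algebra admits a retraction. \textbf{Proposition.} A ring $R$ is fppf-local if and only if it is a henselian local ring and every finite fppf $R$-algebra admits a retraction. -/

import Mathlib

universe u

/-- An `R`-algebra `B` is *fppf* if it is faithfully flat as an `R`-module and of finite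
presentation as an `R`-algebra. -/
structure IsFppfAlgebra (R B : Type u) [CommRing R] [CommRing B] [Algebra R B] : Prop where
  faithfullyFlat : Module.FaithfullyFlat R B
  finitePresentation : Algebra.FinitePresentation R B

/-- The structure homomorphism `R → B` of an `R`-algebra admits a *retraction*: there is a ring
homomorphism `B → R` such that the composite `R → B → R` is the identity. -/
def AdmitsRetraction (R B : Type u) [CommRing R] [CommRing B] [Algebra R B] : Prop :=
  ∃ r : B →+* R, r.comp (algebraMap R B) = RingHom.id R

/-- A commutative ring `R` is *fppf-local* if it is local and every fppf `R`-algebra admits a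
retraction. An `R`-algebra of finite presentation is isomorphic to one in the universe
of `R`, so nothing is lost by letting `B` range over that universe. -/
structure IsFppfLocal (R : Type u) [CommRing R] : Prop where
  isLocalRing : IsLocalRing R
  admitsRetraction : ∀ (B : Type u) [CommRing B] [Algebra R B],
    IsFppfAlgebra R B → AdmitsRetraction R B

section

open TensorProduct IsLocalRing Polynomial

/-! For the converse it suffices to map an fppf algebra `B` to a finite fppf algebra: a retraction
of the latter restricts to `B`. Let `m` be the maximal ideal of `R`. Noether normalization of the
closed fibre makes `B` quasi-finite over a polynomial ring `P` at a prime over `mP`, the generic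
point of the closed fibre of `P`. Étale locally there, `B` has a finite part, and the maximal ideal
of the base is extended from `R`, so flatness over `R` forces freeness
(`Module.free_of_flat_of_map_eq_maximalIdeal`). This yields `D`, flat and quasi-finite over `P`. A
closed point of the closed fibre of `D` has coordinates in a finite extension of the residue field;
they lift to a finite free `R`-algebra, and base change of `D` along this lift is flat and
quasi-finite over `R`. The henselian property then splits off a finite part. Throughout, a
homomorphism to a field killing `m` records that the closed fibre is nonempty. -/

/-! ### Flatness over local rings -/

/-- A flat algebra over a local ring is faithfully flat if its closed fibre has a point. -/
theorem Module.FaithfullyFlat.of_flat_of_ringHom_field {R B K : Type*} [CommRing R]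
    [IsLocalRing R] [CommRing B] [Algebra R B] [Field K] [Module.Flat R B] (φ : B →+* K)
    (hφ : ∀ x ∈ maximalIdeal R, φ (algebraMap R B x) = 0) : Module.FaithfullyFlat R B := by
  refine ⟨fun {m} hm h ↦ ?_⟩
  obtain rfl := IsLocalRing.eq_maximalIdeal hm
  rw [Ideal.smul_top_eq_map] at h
  have h1 : (1 : B) ∈ (maximalIdeal R).map (algebraMap R B) := by
    have : (1 : B) ∈ (⊤ : Submodule R B) := trivial
    rw [← h] at this
    exact this
  have h2 : (maximalIdeal R).map (algebraMap R B) ≤ RingHom.ker φ :=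
    Ideal.map_le_iff_le_comap.mpr fun x hx ↦ hφ x hx
  have := h2 h1
  simp at this

/-- Fibrewise freeness: let `S` be a local ring, flat over `R`, whose maximal ideal is extended from `R`.
A finitely presented `S`-module that is flat over `R` is free over `S`. -/
theorem Module.free_of_flat_of_map_eq_maximalIdeal {R S M : Type*} [CommRing R] [CommRing S]
    [IsLocalRing S] [Algebra R S] [Module.Flat R S] [AddCommGroup M] [Module R M] [Module S M]
    [IsScalarTower R S M] [Module.FinitePresentation S M] [Module.Flat R M] (I : Ideal R)
    (hI : I.map (algebraMap R S) = maximalIdeal S) : Module.Free S M := by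
  apply Module.free_of_maximalIdeal_rTensor_injective
  -- `I ⊗[R] M → maximalIdeal S ⊗[S] M` is surjective and its composite to `S ⊗[S] M` is injective
  let j : I →ₗ[R] maximalIdeal S :=
    LinearMap.codRestrict ((maximalIdeal S).restrictScalars R)
      ((Algebra.linearMap R S).comp I.subtype)
      fun x ↦ hI ▸ Ideal.mem_map_of_mem (algebraMap R S) x.2
  let g : I ⊗[R] M →ₗ[R] maximalIdeal S ⊗[S] M :=
    TensorProduct.lift (((TensorProduct.mk S (maximalIdeal S) M).restrictScalars₁₂ R R).comp j)
  have hg : ∀ x m, g (x ⊗ₜ m) = j x ⊗ₜ m := fun x m ↦ rfl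
  have hgs : Function.Surjective g := by
    intro z
    induction z with
    | zero => exact ⟨0, map_zero _⟩
    | add x y hx hy =>
      obtain ⟨x, rfl⟩ := hx
      obtain ⟨y, rfl⟩ := hy
      exact ⟨x + y, map_add _ _ _⟩
    | tmul x m =>
      obtain ⟨x, hx⟩ := x
      have hx' := hx
      rw [← hI] at hx'
      induction hx' using Submodule.span_induction generalizing m with
      | mem x h =>
        obtain ⟨a, ha, rfl⟩ := h
        exact ⟨⟨a, ha⟩ ⊗ₜ m, by rw [hg]; rfl⟩
      | zero => exact ⟨0, by rw [map_zero]; exact (TensorProduct.zero_tmul _ m).symm⟩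
      | add x y h1 h2 ih1 ih2 =>
        obtain ⟨u, hu⟩ := ih1 m (hI ▸ h1)
        obtain ⟨v, hv⟩ := ih2 m (hI ▸ h2)
        exact ⟨u + v, by rw [map_add, hu, hv, ← TensorProduct.add_tmul]; rfl⟩
      | smul s x h ih =>
        -- The scalar moves across the tensor product, which is why `m` is generalized.
        obtain ⟨u, hu⟩ := ih (s • m) (hI ▸ h)
        exact ⟨u, by rw [hu, TensorProduct.tmul_smul, TensorProduct.smul_tmul']; rfl⟩
  have hinj : Function.Injective (I.subtype.rTensor M) :=
    Module.Flat.rTensor_preserves_injective_linearMap _ Subtype.val_injective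
  intro a b hab
  obtain ⟨a, rfl⟩ := hgs a
  obtain ⟨b, rfl⟩ := hgs b
  have key : ∀ z, TensorProduct.lid S M ((maximalIdeal S).subtype.rTensor M (g z)) =
      TensorProduct.lid R M (I.subtype.rTensor M z) := by
    intro z
    induction z with
    | zero => simp
    | add x y hx hy => simp only [map_add, hx, hy]
    | tmul x m =>
      rw [hg]
      simp only [LinearMap.rTensor_tmul, TensorProduct.lid_tmul]
      exact algebraMap_smul S (x : R) m
  have := congrArg (TensorProduct.lid S M) hab
  rw [key, key] at this
  rw [hinj ((TensorProduct.lid R M).injective this)]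

/-! ### Étale sections and finite parts over henselian rings -/

/-- An étale algebra over a henselian local ring has a section through every point of its closed
fibre with trivial residue field extension. -/
theorem HenselianLocalRing.exists_algHom_of_etale {R A : Type u} [CommRing R]
    [HenselianLocalRing R] [CommRing A] [Algebra R A] [Algebra.Etale R A] (P : Ideal A)
    [P.IsPrime] [P.LiesOver (maximalIdeal R)]
    (hP : Function.Bijective
      (Ideal.ResidueField.mapₐ (maximalIdeal R) P (Algebra.ofId _ _) (P.over_def _))) :
    ∃ s : A →ₐ[R] R, ∀ a, algebraMap R P.ResidueField (s a) = algebraMap A P.ResidueField a := by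
  obtain ⟨f, hf, _⟩ := Algebra.IsEtaleAt.exists_isStandardEtale (R := R) P
  let ψ : Localization.Away f →ₐ[A] P.ResidueField :=
    IsLocalization.Away.liftAlgHom f (f := Algebra.ofId A P.ResidueField)
      (by simpa [Algebra.ofId_apply] using hf)
  obtain ⟨Q⟩ := (inferInstance : Nonempty (StandardEtalePresentation R (Localization.Away f)))
  have hsurj : Function.Surjective (algebraMap R P.ResidueField) := by
    have h1 : Function.Surjective (algebraMap R (maximalIdeal R).ResidueField) :=
      Ideal.algebraMap_residueField_surjective _
    intro y
    obtain ⟨z, rfl⟩ := hP.2 y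
    obtain ⟨r, rfl⟩ := h1 z
    exact ⟨r, by simp⟩
  have hx : Q.P.HasMap (ψ Q.x) := Q.hasMap.map (ψ.restrictScalars R)
  -- A section of a standard étale algebra is a root of its monic polynomial; the given point
  -- provides a simple root in the residue field.
  have hH := ((HenselianLocalRing.TFAE R).out 0 2).mp ‹_›
  obtain ⟨a, ha, ha'⟩ := hH (algebraMap R P.ResidueField) hsurj Q.f Q.monic_f (ψ Q.x)
    hx.1 (by simpa [Polynomial.aeval_def] using hx.isUnit_derivative_f.ne_zero)
  have hunit : ∀ r : R, algebraMap R P.ResidueField r ≠ 0 → IsUnit r := by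
    intro r hr
    by_contra h
    apply hr
    rw [IsScalarTower.algebraMap_apply R A, Ideal.algebraMap_residueField_eq_zero]
    exact (P.over_def (maximalIdeal R)).le h
  have hmap : Q.P.HasMap a := by
    refine ⟨by simpa [Polynomial.aeval_def] using ha, hunit _ ?_⟩
    have := hx.2.ne_zero
    rw [← ha', Polynomial.aeval_algebraMap_apply] at this
    exact this
  let s₀ : Localization.Away f →ₐ[R] R := (Q.lift a hmap).comp Q.equivRing.toAlgHom
  have hs₀ : (Algebra.ofId R P.ResidueField).comp s₀ = ψ.restrictScalars R := by
    apply Q.hom_ext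
    simp [s₀, ha', Algebra.ofId_apply]
  refine ⟨s₀.comp (IsScalarTower.toAlgHom R A _), fun b ↦ ?_⟩
  have := DFunLike.congr_fun hs₀ (algebraMap A _ b)
  simpa [Algebra.ofId_apply] using this

/-- A flat quasi-finite algebra of finite presentation over a henselian local ring, with nonempty
closed fibre, maps to a finite fppf algebra. -/
theorem Algebra.QuasiFinite.exists_finite_fppf {R Q K : Type u} [CommRing R]
    [HenselianLocalRing R] [CommRing Q] [Algebra R Q] [Module.Flat R Q]
    [Algebra.FinitePresentation R Q] [Algebra.QuasiFinite R Q] [Field K] (φ : Q →+* K)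
    (hφ : ∀ x ∈ maximalIdeal R, φ (algebraMap R Q x) = 0) :
    ∃ (C : Type u) (_ : CommRing C) (_ : Algebra R C) (_ : Q →ₐ[R] C),
      Module.Finite R C ∧ IsFppfAlgebra R C := by
  let q : Ideal Q := RingHom.ker φ
  have hqp : q.IsPrime := RingHom.ker_isPrime φ
  have hqm : q.LiesOver (maximalIdeal R) := ⟨le_antisymm hφ
    (IsLocalRing.le_maximalIdeal_of_isPrime _)⟩
  obtain ⟨R', _, _, _, P, _, _, e, he, P', _, _, hP'q, heP', hP, hfin, -⟩ :=
    Algebra.exists_etale_isIdempotentElem_forall_liesOver_eq (maximalIdeal R) q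
  obtain ⟨s, hs⟩ := HenselianLocalRing.exists_algHom_of_etale P hP
  let B := Localization.Away e
  -- `R` becomes an `R'`-algebra through the section, so the finite part `B` descends to `R ⊗[R']
  -- B`.
  algebraize [s.toRingHom]
  have : IsScalarTower R R' R := .of_algebraMap_eq' s.comp_algebraMap.symm
  have : Algebra.FinitePresentation R' B := .trans R' (R' ⊗[R] Q) B
  have : Module.Flat R' B := .trans R' (R' ⊗[R] Q) B
  let ψ : B →ₐ[R' ⊗[R] Q] P'.ResidueField :=
    IsLocalization.Away.liftAlgHom e (f := Algebra.ofId _ P'.ResidueField)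
      (by simpa [Algebra.ofId_apply] using heP')
  let κ : P.ResidueField →ₐ[R'] P'.ResidueField :=
    Ideal.ResidueField.mapₐ P P' (Algebra.ofId _ _) (P'.over_def P)
  let ρ : R →ₐ[R'] P'.ResidueField :=
    ⟨κ.toRingHom.comp (algebraMap R P.ResidueField), fun a ↦
      (congrArg κ (hs a)).trans (κ.commutes a)⟩
  let χ : R ⊗[R'] B →ₐ[R'] P'.ResidueField :=
    Algebra.TensorProduct.lift ρ (ψ.restrictScalars R') fun _ _ ↦ .all _ _
  have hρ : ∀ x ∈ maximalIdeal R, ρ x = 0 := fun x hx ↦ by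
    have : algebraMap R P.ResidueField x = 0 := by
      rw [IsScalarTower.algebraMap_apply R R', Ideal.algebraMap_residueField_eq_zero]
      exact (P.over_def (maximalIdeal R)).le hx
    exact (congrArg κ this).trans (map_zero κ)
  let ι : Q →+* R ⊗[R'] B := ((Algebra.TensorProduct.includeRight (R := R') (A := R)).toRingHom.comp
    (algebraMap (R' ⊗[R] Q) B)).comp (Algebra.TensorProduct.includeRight (R := R) (A := R')).toRingHom
  refine ⟨R ⊗[R'] B, inferInstance, inferInstance, ⟨ι, fun x ↦ ?_⟩, inferInstance,
    .of_flat_of_ringHom_field χ.toRingHom fun x hx ↦ ?_, inferInstance⟩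
  · have h1 : Algebra.TensorProduct.includeRight (R := R) (A := R') (algebraMap R Q x) =
        algebraMap R' (R' ⊗[R] Q) (algebraMap R R' x) := by
      rw [AlgHom.commutes, ← IsScalarTower.algebraMap_apply]
    have h2 : ι (algebraMap R Q x) = algebraMap R' (R ⊗[R'] B) (algebraMap R R' x) := by
      simp only [ι, RingHom.comp_apply, AlgHom.toRingHom_eq_coe, RingHom.coe_coe, h1,
        ← IsScalarTower.algebraMap_apply R' _ B, AlgHom.commutes]
    have h3 : algebraMap R' R (algebraMap R R' x) = x :=
      (IsScalarTower.algebraMap_apply R R' R x).symm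
    exact h2.trans (congrArg (· ⊗ₜ[R'] (1 : B)) h3)
  · have : χ (x ⊗ₜ 1) = ρ x * 1 := by simp [χ]
    exact this.trans (by rw [hρ x hx, zero_mul])

/-! ### Fppf-local rings are henselian -/

/-- An fppf-local ring is henselian: a simple root of `f` modulo the maximal ideal lifts by a retraction
of `(R[X]/f)[1/G]`, where `f = (X - a₀) G + f(a₀)`. -/
theorem IsFppfLocal.henselianLocalRing {R : Type u} [CommRing R] (h : IsFppfLocal R) :
    HenselianLocalRing R := by
  have := h.isLocalRing
  refine { is_henselian := fun f hf a₀ h₁ h₂ ↦ ?_ }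
  let G : R[X] := f /ₘ (X - C a₀)
  have hG : (X - C a₀) * G + C (f.eval a₀) = f := by
    rw [add_comm, ← modByMonic_X_sub_C_eq_C_eval]
    exact modByMonic_add_div _ _
  have hGa : G.eval a₀ = f.derivative.eval a₀ := by
    conv_rhs => rw [← hG]
    simp
  let A := AdjoinRoot f
  let g : A := AdjoinRoot.mk f G
  let B := Localization.Away g
  have := hf.free_adjoinRoot
  have := hf.finite_adjoinRoot
  have : Module.Flat R B := .trans R A B
  have : Module.FinitePresentation R A := Module.finitePresentation_of_projective R A
  have : Algebra.FinitePresentation R B := .trans R A B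
  let φ₀ : A →+* ResidueField R := AdjoinRoot.lift (residue R) (residue R a₀)
    (by rw [eval₂_at_apply]; exact (residue_eq_zero_iff _).mpr h₁)
  let φ : B →+* ResidueField R := IsLocalization.Away.lift (g := φ₀) g (by
    have hg : φ₀ g = residue R (f.derivative.eval a₀) := by
      rw [← hGa, ← eval₂_at_apply]
      exact AdjoinRoot.lift_mk _ _
    exact hg ▸ h₂.map _)
  have hB : IsFppfAlgebra R B := ⟨.of_flat_of_ringHom_field φ fun x hx ↦ by
    rw [IsScalarTower.algebraMap_apply R A B, IsLocalization.Away.lift_eq]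
    exact (AdjoinRoot.lift_of _).trans ((residue_eq_zero_iff _).mpr hx), inferInstance⟩
  obtain ⟨r, hr⟩ := h.admitsRetraction B hB
  let t : A →ₐ[R] R := ⟨r.comp (algebraMap A B), fun x ↦ by
    simpa [← IsScalarTower.algebraMap_apply] using DFunLike.congr_fun hr x⟩
  have ht (p : R[X]) : t (AdjoinRoot.mk f p) = p.eval (t (AdjoinRoot.root f)) := by
    rw [← AdjoinRoot.aeval_eq, ← Polynomial.aeval_algHom_apply, Polynomial.coe_aeval_eq_eval]
  have hroot : f.eval (t (AdjoinRoot.root f)) = 0 := by rw [← ht]; simp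
  have hunit : IsUnit (G.eval (t (AdjoinRoot.root f))) := by
    rw [← ht]
    exact (IsLocalization.Away.algebraMap_isUnit (S := B) g).map r
  refine ⟨_, hroot, ?_⟩
  have key := congrArg (eval (t (AdjoinRoot.root f))) hG
  rw [hroot] at key
  simp only [eval_add, eval_mul, eval_sub, eval_X, eval_C] at key
  have : (t (AdjoinRoot.root f) - a₀) * G.eval (t (AdjoinRoot.root f)) ∈ maximalIdeal R := by
    rw [eq_neg_of_add_eq_zero_left key]
    exact neg_mem h₁
  exact (Ideal.mul_unit_mem_iff_mem _ hunit).mp this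

/-! ### Reduction to relative dimension zero -/

/-- A finite type extension of the residue field of a local ring is finite. -/
theorem IsLocalRing.finite_of_finiteType_field {R L : Type*} [CommRing R] [IsLocalRing R] [Field L]
    [Algebra R L] [Algebra.FiniteType R L] (h : ∀ x ∈ maximalIdeal R, algebraMap R L x = 0) :
    Module.Finite R L := by
  let k := R ⧸ maximalIdeal R
  let : Field k := Ideal.Quotient.field _
  let : Algebra k L := (Ideal.Quotient.lift (maximalIdeal R) (algebraMap R L) h).toAlgebra
  have : IsScalarTower R k L := .of_algebraMap_eq fun x ↦ rfl
  have : Algebra.FiniteType k L := .of_restrictScalars_finiteType R k L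
  have : Module.Finite k L := finite_of_finite_type_of_isJacobsonRing k L
  exact .trans k L

/-- An algebra that is flat and quasi-finite over a polynomial ring over a local ring `R`, with nonempty
closed fibre, maps to a flat quasi-finite `R`-algebra with nonempty closed fibre. -/
theorem Algebra.exists_quasiFinite_flat_of_mvPolynomial {R D K : Type u} [CommRing R]
    [IsLocalRing R] {n : ℕ} [CommRing D] [Algebra R D] [Algebra (MvPolynomial (Fin n) R) D]
    [IsScalarTower R (MvPolynomial (Fin n) R) D] [Module.Flat (MvPolynomial (Fin n) R) D]
    [Algebra.QuasiFinite (MvPolynomial (Fin n) R) D] [Algebra.FinitePresentation R D] [Field K]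
    (φ : D →+* K) (hφ : ∀ x ∈ maximalIdeal R, φ (algebraMap R D x) = 0) :
    ∃ (Q L : Type u) (_ : CommRing Q) (_ : Algebra R Q) (_ : Field L) (_ : D →ₐ[R] Q)
      (ψ : Q →+* L), Module.Flat R Q ∧ Algebra.QuasiFinite R Q ∧
        Algebra.FinitePresentation R Q ∧ ∀ x ∈ maximalIdeal R, ψ (algebraMap R Q x) = 0 := by
  let P := MvPolynomial (Fin n) R
  have hle : (maximalIdeal R).map (algebraMap R D) ≤ RingHom.ker φ :=
    Ideal.map_le_iff_le_comap.mpr fun x hx ↦ hφ x hx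
  obtain ⟨M, hM, hmM⟩ := Ideal.exists_le_maximal _
    (ne_top_of_le_ne_top (RingHom.ker_ne_top φ) hle)
  let L := D ⧸ M
  let : Field L := Ideal.Quotient.field M
  have hL : ∀ x ∈ maximalIdeal R, algebraMap R L x = 0 := fun x hx ↦
    Ideal.Quotient.eq_zero_iff_mem.mpr (hmM (Ideal.mem_map_of_mem _ hx))
  have : Module.Finite R L := IsLocalRing.finite_of_finiteType_field hL
  obtain ⟨R', _, _, _, _, _, f, hf⟩ := Module.Finite.exists_free_surjective R L
  choose c hc using fun i : Fin n ↦ hf (algebraMap P L (MvPolynomial.X i))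
  let a : P →ₐ[R] R' := MvPolynomial.aeval c
  algebraize [a.toRingHom]
  have : IsScalarTower R P R' := .of_algebraMap_eq' a.comp_algebraMap.symm
  have hfP : f.comp a = IsScalarTower.toAlgHom R P L := by
    ext i
    simp only [AlgHom.comp_apply, a, MvPolynomial.aeval_X, hc]
    rfl
  let f' : R' →ₐ[P] L := ⟨f.toRingHom, fun p ↦ DFunLike.congr_fun hfP p⟩
  have : Algebra.FinitePresentation P D := .of_restrict_scalars_finitePresentation R P D
  refine ⟨R' ⊗[P] D, L, inferInstance, inferInstance, inferInstance,
    (Algebra.TensorProduct.includeRight (R := P) (A := R')).restrictScalars R,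
    (Algebra.TensorProduct.lift f' (IsScalarTower.toAlgHom P D L) fun _ _ ↦ .all _ _).toRingHom,
    .trans R R' _, .trans R R' _, .trans R R' _, fun x hx ↦ ?_⟩
  have : (Algebra.TensorProduct.lift f' (IsScalarTower.toAlgHom P D L) fun _ _ ↦ .all _ _)
      (algebraMap R R' x ⊗ₜ 1) = f (algebraMap R R' x) * 1 := by
    simp [f']
  rw [f.commutes, hL x hx, zero_mul] at this
  exact this

/-- Noether normalization of the closed fibre, lifted to the local base. -/
theorem Algebra.exists_mvPolynomial_quasiFiniteAt {R B K : Type u} [CommRing R]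
    [IsLocalRing R] [CommRing B] [Algebra R B] [Algebra.FinitePresentation R B] [Field K]
    (φ : B →+* K) (hφ : ∀ x ∈ maximalIdeal R, φ (algebraMap R B x) = 0) :
    ∃ (n : ℕ) (_ : Algebra (MvPolynomial (Fin n) R) B)
      (_ : IsScalarTower R (MvPolynomial (Fin n) R) B) (q : Ideal B) (_ : q.IsPrime)
      (_ : q.LiesOver ((maximalIdeal R).map (algebraMap R (MvPolynomial (Fin n) R)))),
        Algebra.QuasiFiniteAt (MvPolynomial (Fin n) R) q := by
  let k := R ⧸ maximalIdeal R
  let : Field k := Ideal.Quotient.field _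
  let mB := (maximalIdeal R).map (algebraMap R B)
  have hle : mB ≤ RingHom.ker φ := Ideal.map_le_iff_le_comap.mpr fun x hx ↦ hφ x hx
  have hne : mB ≠ ⊤ := ne_top_of_le_ne_top (RingHom.ker_ne_top φ) hle
  let B' := B ⧸ mB
  have : Nontrivial B' := Ideal.Quotient.nontrivial_iff.mpr hne
  let : Algebra k B' := (Ideal.quotientMap mB (algebraMap R B) Ideal.le_comap_map).toAlgebra
  have : IsScalarTower R k B' := .of_algebraMap_eq fun x ↦ rfl
  have : Algebra.FiniteType k B' := .of_restrictScalars_finiteType R k B'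
  obtain ⟨n, g, hg, hgfin⟩ := exists_finite_inj_algHom_of_fg k B'
  let P := MvPolynomial (Fin n) R
  let A := MvPolynomial (Fin n) k
  choose b hb using fun i : Fin n ↦ Ideal.Quotient.mk_surjective (g (MvPolynomial.X i))
  let a : P →ₐ[R] B := MvPolynomial.aeval b
  algebraize [a.toRingHom, g.toRingHom]
  have : IsScalarTower R P B := .of_algebraMap_eq' a.comp_algebraMap.symm
  let π : P →+* A := MvPolynomial.map (algebraMap R k)
  have hπ : Function.Surjective π := MvPolynomial.map_surjective _ Ideal.Quotient.mk_surjective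
  have hcomp : (algebraMap A B').comp π = algebraMap P B' := by
    refine MvPolynomial.ringHom_ext (fun r ↦ ?_) fun i ↦ ?_
    · change g (MvPolynomial.map (algebraMap R k) (MvPolynomial.C r)) =
        algebraMap P B' (algebraMap R P r)
      rw [← IsScalarTower.algebraMap_apply, MvPolynomial.map_C, ← MvPolynomial.algebraMap_eq,
        g.commutes]
      rfl
    · change g (MvPolynomial.map (algebraMap R k) (MvPolynomial.X i)) =
        Ideal.Quotient.mk mB (a (MvPolynomial.X i))
      rw [MvPolynomial.map_X, ← hb]
      exact congrArg _ (MvPolynomial.aeval_X b i).symm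
  have hker : RingHom.ker π = (maximalIdeal R).map (algebraMap R P) := by
    refine (MvPolynomial.ker_map (algebraMap R k)).trans ?_
    rw [show RingHom.ker (algebraMap R k) = maximalIdeal R from Ideal.mk_ker]
    rfl
  have hfinP : Module.Finite P B' := by
    rw [← RingHom.finite_algebraMap, ← hcomp]
    exact RingHom.Finite.comp hgfin (.of_surjective _ hπ)
  have hinj : Function.Injective (algebraMap A B') := hg
  have : Module.Finite A B' := hgfin
  -- Choosing a prime over zero makes its preimage in `B` contract to exactly the extension of the
  -- maximal ideal.
  obtain ⟨Q, -, hQ, hQ0⟩ := Ideal.exists_ideal_over_prime_of_isIntegral (⊥ : Ideal A) (⊥ : Ideal B')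
    (by rw [← RingHom.ker_eq_comap_bot, (RingHom.injective_iff_ker_eq_bot _).mp hinj])
  let q : Ideal B := Q.comap (Ideal.Quotient.mk mB)
  have hqP : q.under P = (maximalIdeal R).map (algebraMap R P) := by
    have : q.under P = Q.comap (algebraMap P B') := rfl
    rw [this, ← hcomp, ← Ideal.comap_comap, hQ0, ← RingHom.ker_eq_comap_bot, hker]
  refine ⟨n, inferInstance, inferInstance, q, inferInstance, ⟨hqP.symm⟩, ?_⟩
  have : Algebra.FiniteType P B := .of_restrictScalars_finiteType R P B
  have heq : (q.under P).map (algebraMap P B) = mB := by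
    rw [hqP, Ideal.map_map, ← IsScalarTower.algebraMap_eq]
  have : Module.Finite P (B ⧸ (q.under P).map (algebraMap P B)) := by
    rw [heq]
    exact hfinP
  have : Algebra.WeaklyQuasiFiniteAt P q := by
    delta Algebra.WeaklyQuasiFiniteAt
    infer_instance
  exact .of_weaklyQuasiFiniteAt q

theorem Module.Flat.tensorProduct_of_isScalarTower (R : Type*) {A B C : Type*} [CommRing R]
    [CommRing A] [CommRing B] [CommRing C] [Algebra R A] [Algebra R B] [Algebra R C] [Algebra A B]
    [Algebra A C] [IsScalarTower R A B] [IsScalarTower R A C] [Module.Flat R B]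
    [Module.Flat A C] : Module.Flat R (C ⊗[A] B) :=
  have : Module.Flat R (B ⊗[A] C) := .trans R B (B ⊗[A] C)
  .of_linearEquiv ((TensorProduct.comm A C B).restrictScalars R)

/-- Let `P → B` be a map of flat algebras of finite presentation over a local ring `R` that is
quasi-finite at a prime over the extension of the maximal ideal of `R`. Then `B` maps to an algebra
with nonempty closed fibre that is flat and quasi-finite over `P`. -/
theorem Algebra.exists_flat_of_quasiFiniteAt {R P B : Type u} [CommRing R] [IsLocalRing R]
    [CommRing P] [Algebra R P] [Module.Flat R P] [Algebra.FinitePresentation R P] [CommRing B]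
    [Algebra R B] [Algebra P B] [IsScalarTower R P B] [Module.Flat R B]
    [Algebra.FinitePresentation R B] (q : Ideal B) [q.IsPrime]
    [q.LiesOver ((maximalIdeal R).map (algebraMap R P))] [Algebra.QuasiFiniteAt P q] :
    ∃ (D K : Type u) (_ : CommRing D) (_ : Algebra R D) (_ : Algebra P D)
      (_ : IsScalarTower R P D) (_ : Field K) (_ : B →ₐ[R] D) (φ : D →+* K),
      Module.Flat P D ∧ Algebra.QuasiFinite P D ∧ Algebra.FinitePresentation R D ∧
        ∀ x ∈ maximalIdeal R, φ (algebraMap R D x) = 0 := by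
  let p : Ideal P := (maximalIdeal R).map (algebraMap R P)
  have hp : p.IsPrime := by
    rw [q.over_def p]
    infer_instance
  have : Algebra.FinitePresentation P B := .of_restrict_scalars_finitePresentation R P B
  obtain ⟨P', _, _, _, p', _, _, e, he, q', _, _, -, heq', -, hfin, -⟩ :=
    Algebra.exists_etale_isIdempotentElem_forall_liesOver_eq p q
  let : Algebra R P' := ((algebraMap P P').comp (algebraMap R P)).toAlgebra
  have : IsScalarTower R P P' := .of_algebraMap_eq fun _ ↦ rfl
  let B' := Localization.Away e
  have : Algebra.FinitePresentation P' B' := .trans P' (P' ⊗[P] B) B'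
  have : Module.FinitePresentation P' B' := .of_finite_of_finitePresentation P' B'
  have : Module.Flat R (P' ⊗[P] B) := .tensorProduct_of_isScalarTower R
  have : Module.Flat R B' := .trans R (P' ⊗[P] B) B'
  let S := Localization.AtPrime p'
  have : Module.Flat R P' := .trans R P P'
  have : Module.Flat R S := .trans R P' S
  -- `p` is extended from `R`, and unramifiedness makes it generate the maximal ideal of `S`.
  have hS : (maximalIdeal R).map (algebraMap R S) = maximalIdeal S := by
    let := Localization.AtPrime.algebraOfLiesOver p p'
    have : Algebra.IsUnramifiedAt P p' := inferInstance
    have := ((Algebra.isUnramifiedAt_iff_map_eq P p p').mp this).2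
    rwa [Ideal.map_map, ← IsScalarTower.algebraMap_eq] at this
  have : Module.Flat R (S ⊗[P'] B') := .tensorProduct_of_isScalarTower R
  have : Module.Free S (S ⊗[P'] B') := Module.free_of_flat_of_map_eq_maximalIdeal _ hS
  -- Freeness at `p'` spreads out to a basic open set; as `h` avoids `p'`, the point `q'` survives.
  obtain ⟨h, hh, hfree, -⟩ := Module.FinitePresentation.exists_free_localizedModule_powers
    p'.primeCompl (TensorProduct.mk P' S B' 1) S
  let T := Localization.Away h
  let D := T ⊗[P'] B'
  have : Module.Free T D := .of_equiv (LocalizedModule.equivTensorProduct (.powers h) B')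
  have : Module.Flat T D := .of_free
  have : Module.Flat P T := .trans P P' T
  have : Module.Flat P D := .trans P T D
  have : Algebra.QuasiFinite P D := .trans P T D
  have : Algebra.FinitePresentation P T := .trans P P' T
  have : Algebra.FinitePresentation P D := .trans P T D
  let K := q'.ResidueField
  let ψ : B' →ₐ[P' ⊗[P] B] K :=
    IsLocalization.Away.liftAlgHom e (f := Algebra.ofId _ K)
      (by simpa [Algebra.ofId_apply, K] using heq')
  have hK (x : P') : algebraMap P' K x = 0 ↔ x ∈ p' := by
    rw [IsScalarTower.algebraMap_apply P' (P' ⊗[P] B) K, Ideal.algebraMap_residueField_eq_zero,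
      q'.over_def p']
    rfl
  let χ : T →ₐ[P'] K := IsLocalization.Away.liftAlgHom h (f := Algebra.ofId _ K)
    (isUnit_iff_ne_zero.mpr ((hK h).not.mpr hh))
  let φ : D →ₐ[P'] K := Algebra.TensorProduct.lift χ (ψ.restrictScalars P') fun _ _ ↦ .all _ _
  let ι : B →ₐ[P] D :=
    ((Algebra.TensorProduct.includeRight (R := P') (A := T) (B := B')).restrictScalars P).comp
      ((IsScalarTower.toAlgHom P (P' ⊗[P] B) B').comp Algebra.TensorProduct.includeRight)
  refine ⟨D, K, inferInstance, inferInstance, inferInstance, inferInstance, inferInstance,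
    ι.restrictScalars R, φ.toRingHom, inferInstance, inferInstance, .trans R P D, fun x hx ↦ ?_⟩
  have : φ (algebraMap P' D (algebraMap R P' x)) = 0 := by
    rw [φ.commutes, hK]
    exact (p'.over_def p).le (Ideal.mem_map_of_mem _ hx)
  rwa [← IsScalarTower.algebraMap_apply R P' D] at this

/-- A henselian local ring over which every finite fppf algebra has a retraction is fppf-local. -/
theorem isFppfLocal_of_henselianLocalRing {R : Type u} [CommRing R] [HenselianLocalRing R]
    (H : ∀ (B : Type u) [CommRing B] [Algebra R B],
      Module.Finite R B → IsFppfAlgebra R B → AdmitsRetraction R B) : IsFppfLocal R := by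
  refine ⟨inferInstance, fun B _ _ hB ↦ ?_⟩
  have := hB.faithfullyFlat
  have := hB.finitePresentation
  obtain ⟨q₀, _, _⟩ := Ideal.exists_isPrime_liesOver_of_faithfullyFlat (B := B) (maximalIdeal R)
  obtain ⟨n, _, _, q, _, _, _⟩ := Algebra.exists_mvPolynomial_quasiFiniteAt
    (algebraMap B q₀.ResidueField) fun x hx ↦ by
      rw [Ideal.algebraMap_residueField_eq_zero]
      exact (q₀.over_def (maximalIdeal R)).le hx
  obtain ⟨D, _, _, _, _, _, _, f, φ, _, _, _, hφ⟩ :=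
    Algebra.exists_flat_of_quasiFiniteAt (R := R) (P := MvPolynomial (Fin n) R) q
  obtain ⟨Q, _, _, _, _, g, ψ, _, _, _, hψ⟩ :=
    Algebra.exists_quasiFinite_flat_of_mvPolynomial (n := n) φ hφ
  obtain ⟨C, _, _, h, hfin, hC⟩ := Algebra.QuasiFinite.exists_finite_fppf ψ hψ
  obtain ⟨r, hr⟩ := H C hfin hC
  refine ⟨r.comp ((h.comp g).comp f).toRingHom, ?_⟩
  rw [RingHom.comp_assoc, AlgHom.toRingHom_eq_coe, AlgHom.comp_algebraMap, hr]

end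

theorem mainTheorem9 (R : Type u) [CommRing R] :
    IsFppfLocal R ↔
      (HenselianLocalRing R ∧
        ∀ (B : Type u) [CommRing B] [Algebra R B],
          Module.Finite R B → IsFppfAlgebra R B → AdmitsRetraction R B) :=
  ⟨fun h ↦ ⟨h.henselianLocalRing, fun B _ _ _ hB ↦ h.admitsRetraction B hB⟩,
    fun ⟨_, H⟩ ↦ isFppfLocal_of_henselianLocalRing H⟩
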